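/- **Theorem (Soundness, supermartingale maps).** Consider a single probabilistic while loop $P = $ **while** $\phi$ **do** $Q$ **od** over finitely many integer-valued program variables $X$ and sampling variables $R$, where $\phi$ is a propositional combination of comparisons of arithmetic expressions over $X$, and $Q$ is a loop-free program (built from **skip**, assignments of arithmetic expressions over $X\cup R$ to program variables, sequential composition, and **if**-**then**-**else** with such Boolean conditions). Each sampling variable $r_i\in R$ has a discrete probability distribution $\Upsilon(r_i)$ over $\mathbb{Z}$; let $\bar\Upsilon(\mathbf{r})=\prod_{i}\Upsilon(r_i)(\mathbf{r}[i])$ for $\mathbf{r}\in\mathbb{Z}^{|R|}$, with support $\operatorname{supp}\bar\Upsilon=\{\mathbf r:\bar\Upsilon(\mathbf r)>0\}$, and let $F(\mathbf{v},\mathbf{r})\in\mathbb{Z}^{|X|}$ be the program valuation after executing $Q$ from the program valuation $\mathbf{v}\in\mathbb{Z}^{|X|}$ with sampled values $\mathbf{r}$. The semantics of $P$ is the Markov chain $\{(\ell_n,\mathbf{v}_n)\}_{n\ge 0}$ on $\{\mathtt{in},\mathtt{out}\}\times\mathbb{Z}^{|X|}$ with the following transitions: from $(\mathtt{in},\mathbf{v})$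 with $\mathbf{v}\models\phi$ it moves to $(\mathtt{in},\mathbf{v}')$ with probability $\sum_{\mathbf{r}:\,F(\mathbf{v},\mathbf{r})=\mathbf{v}'}\bar\Upsilon(\mathbf{r})$; from $(\mathtt{in},\mathbf{v})$ with $\mathbf{v}\not\models\phi$, and from $(\mathtt{out},\mathbf{v})$, it moves to $(\mathtt{out},\mathbf{v})$ with probability $1$. For an initial valuation $\mathbf{v}_0$, let $\mathbb{P}$ be the law on paths of this chain started in $(\mathtt{in},\mathbf{v}_0)$, and let $T=\min\{n\mid \ell_n=\mathtt{out}\}$, where $\min\emptyset=\infty$. A *difference-bounded supermartingale map* for $P$ is a function $h:\{\mathtt{in},\mathtt{out}\}\times\mathbb{Z}^{|X|}\to\mathbb{R}$ for which there are real numbers $\delta,\zeta>0$ such that, with $g(\mathbf{v},\mathbf{r}):=h(\mathtt{in},F(\mathbf{v},\mathbf{r}))-h(\mathtt{in},\mathbf{v})$: - (D1) $h(\mathtt{out},\mathbf{v})=0$ for all $\mathbf{v}\in\mathbb{Z}^{|X|}$; - (D2) for all $\mathbf{v}\models\phi$: $h(\mathtt{in},\mathbf{v})\ge\delta$, and $h(\mathtt{in},F(\mathbf{v},\mathbf{r}))\ge\delta$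 for all $\mathbf{r}\in\operatorname{supp}\bar\Upsilon$; - (D3) for all $\mathbf{v}\models\phi$: $\sum_{\mathbf{r}}\bar\Upsilon(\mathbf{r})\,h(\mathtt{in},F(\mathbf{v},\mathbf{r}))\le h(\mathtt{in},\mathbf{v})$ and $\sum_{\mathbf{r}}\bar\Upsilon(\mathbf{r})\,|g(\mathbf{v},\mathbf{r})|\ge\delta$; - (D4) for all $\mathbf{v}\models\phi$ and $\mathbf{r}\in\operatorname{supp}\bar\Upsilon$: $|g(\mathbf{v},\mathbf{r})|\le\zeta$, and if $F(\mathbf{v},\mathbf{r})\not\models\phi$ then $h(\mathtt{in},F(\mathbf{v},\mathbf{r}))\le\zeta$. If there exists a difference-bounded supermartingale map $h$ for $P$, then for every initial valuation $\mathbf{v}_0\in\mathbb{Z}^{|X|}$ we have $\mathbb{P}(T<\infty)=1$, and the function $k\mapsto\mathbb{P}(T\ge k)$ is in $\mathcal{O}(1/\sqrt{k})$ as $k\to\infty$. -/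

import Mathlib

open MeasureTheory ProbabilityTheory Filter
open scoped ENNReal

noncomputable section

namespace ProbLoop

/-- Program valuations (`n` program variables, all integer-valued). -/
abbrev PVal (n : ℕ) : Type := Fin n → ℤ

/-- Sampling valuations (`m` sampling variables, all integer-valued). -/
abbrev RVal (m : ℕ) : Type := Fin m → ℤ

/-- Arithmetic expressions over program variables. No particular syntax of arithmetic expressions
is fixed: an expression is identified with the integer function that it denotes, and every such
function is allowed. -/
abbrev PExpr (n : ℕ) : Type := PVal n → ℤ

/-- Arithmetic expressions over program and sampling variables, again with no fixed syntax. -/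
abbrev Expr (n m : ℕ) : Type := PVal n → RVal m → ℤ

/-- Boolean expressions: propositional combinations of comparisons of arithmetic expressions over
program variables. -/
inductive BExpr (n : ℕ) : Type where
  | le (e₁ e₂ : PExpr n) : BExpr n
  | ge (e₁ e₂ : PExpr n) : BExpr n
  | not (b : BExpr n) : BExpr n
  | or (b₁ b₂ : BExpr n) : BExpr n
  | and (b₁ b₂ : BExpr n) : BExpr n

/-- `b.Sat v` says that the valuation `v` satisfies `b`. -/
def BExpr.Sat {n : ℕ} : BExpr n → PVal n → Prop
  | .le e₁ e₂, v => e₁ v ≤ e₂ v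
  | .ge e₁ e₂, v => e₁ v ≥ e₂ v
  | .not b, v => ¬ b.Sat v
  | .or b₁ b₂, v => b₁.Sat v ∨ b₂.Sat v
  | .and b₁ b₂, v => b₁.Sat v ∧ b₂.Sat v

/-- Loop-free programs. -/
inductive LoopFree (n m : ℕ) : Type where
  | skip : LoopFree n m
  | assign (x : Fin n) (e : Expr n m) : LoopFree n m
  | seq (Q₁ Q₂ : LoopFree n m) : LoopFree n m
  | ite (b : BExpr n) (Q₁ Q₂ : LoopFree n m) : LoopFree n m

open Classical in
/-- The program valuation after the execution of a loop-free program, started in the program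
valuation `v`, with the sampled values `r`. -/
def LoopFree.exec {n m : ℕ} : LoopFree n m → PVal n → RVal m → PVal n
  | .skip, v, _ => v
  | .assign x e, v, r => Function.update v x (e v r)
  | .seq Q₁ Q₂, v, r => Q₂.exec (Q₁.exec v r) r
  | .ite b Q₁ Q₂, v, r => if b.Sat v then Q₁.exec v r else Q₂.exec v r

/-- A single probabilistic while loop `while guard do body od`, together with its sampling
function, which gives every sampling variable a discrete probability distribution over `ℤ`. -/
structure WhileLoop (n m : ℕ) : Type where
  guard : BExpr n
  body : LoopFree n m
  sampling : Fin m → PMF ℤ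

/-- The two program counters: the entry point and the terminating point of the loop. -/
inductive Loc : Type where
  | inn : Loc
  | out : Loc

instance : Finite Loc :=
  Finite.of_surjective (fun b : Bool => if b then Loc.inn else Loc.out)
    (fun l => by cases l; exacts [⟨true, rfl⟩, ⟨false, rfl⟩])

instance : MeasurableSpace Loc := ⊤

/-- Configurations: pairs of a program counter and a program valuation. The σ-algebra on this
countable set contains all subsets. -/
abbrev Config (n : ℕ) : Type := Loc × PVal n

/-- The product of discrete distributions has total mass one. -/
theorem hasSum_prod_pmf {m : ℕ} (p : Fin m → PMF ℤ) :
    HasSum (fun r : RVal m => ∏ i, p i (r i)) 1 := by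
  have h : ∑' r : RVal m, ∏ i, p i (r i) = 1 := by
    have h1 : (Measure.pi fun i => (p i).toMeasure) (Set.univ : Set (RVal m)) = 1 :=
      measure_univ
    rw [← h1, ← Measure.tsum_indicator_apply_singleton _ _ MeasurableSet.univ]
    refine tsum_congr fun r => ?_
    simp [Measure.pi_singleton, PMF.toMeasure_apply_singleton]
  exact h ▸ ENNReal.summable.hasSum

/-- The joint distribution of independent samples: `r ↦ ∏ i, p i (r i)`. -/
def jointPMF {m : ℕ} (p : Fin m → PMF ℤ) : PMF (RVal m) :=
  ⟨fun r => ∏ i, p i (r i), hasSum_prod_pmf p⟩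

namespace WhileLoop

variable {n m : ℕ}

/-- The function from valuations to valuations that is encoded by the loop body. -/
def F (P : WhileLoop n m) : PVal n → RVal m → PVal n := P.body.exec

/-- The joint distribution of the sampling variables. -/
def joint (P : WhileLoop n m) : PMF (RVal m) := jointPMF P.sampling

open Classical in
/-- The transition function of the Markov chain: `P.step s s'` is the probability to go from the
configuration `s` to the configuration `s'` in one step. -/
def step (P : WhileLoop n m) : Config n → PMF (Config n)
  | (.inn, v) =>
      if P.guard.Sat v then P.joint.map (fun r => (Loc.inn, P.F v r))
      else PMF.pure (Loc.out, v)
  | (.out, v) => PMF.pure (Loc.out, v)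

/-- The transition function as a Markov kernel. -/
def stepKernel (P : WhileLoop n m) : Kernel (Config n) (Config n) where
  toFun s := (P.step s).toMeasure
  measurable' := Measurable.of_discrete

instance (P : WhileLoop n m) : IsMarkovKernel P.stepKernel :=
  ⟨fun s => inferInstanceAs (IsProbabilityMeasure (P.step s).toMeasure)⟩

/-- The distribution of the configuration at time `k + 1` given the configurations up to time `k`:
it depends on the configuration at time `k` only. -/
def historyKernel (P : WhileLoop n m) (k : ℕ) :
    Kernel ((i : Finset.Iic k) → Config n) (Config n) :=
  P.stepKernel.comap (fun x => x ⟨k, Finset.mem_Iic.2 le_rfl⟩) (measurable_pi_apply _)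

instance (P : WhileLoop n m) (k : ℕ) : IsMarkovKernel (P.historyKernel k) :=
  inferInstanceAs (IsMarkovKernel (P.stepKernel.comap _ _))

/-- The probability measure on paths of the Markov chain with initial configuration
`(in, v₀)`. -/
def pathMeasure (P : WhileLoop n m) (v₀ : PVal n) : Measure (ℕ → Config n) :=
  Kernel.trajMeasure (X := fun _ => Config n) (Measure.dirac ((Loc.inn, v₀) : Config n))
    P.historyKernel

/-- Conditions (D1)--(D4) for the map `h` with the parameters `δ` and `ζ`. The infinite sums in
(D3) converge absolutely, because (D4) bounds the terms that have a non-zero weight. -/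
structure MapConditions (P : WhileLoop n m) (h : Config n → ℝ) (δ ζ : ℝ) : Prop where
  d1 : ∀ v, h (Loc.out, v) = 0
  d2_before : ∀ v, P.guard.Sat v → δ ≤ h (Loc.inn, v)
  d2_after : ∀ v, P.guard.Sat v → ∀ r ∈ P.joint.support, δ ≤ h (Loc.inn, P.F v r)
  d3_super : ∀ v, P.guard.Sat v →
    ∑' r, (P.joint r).toReal * h (Loc.inn, P.F v r) ≤ h (Loc.inn, v)
  d3_change : ∀ v, P.guard.Sat v →
    δ ≤ ∑' r, (P.joint r).toReal * |h (Loc.inn, P.F v r) - h (Loc.inn, v)|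
  d4_change : ∀ v, P.guard.Sat v → ∀ r ∈ P.joint.support,
    |h (Loc.inn, P.F v r) - h (Loc.inn, v)| ≤ ζ
  d4_exit : ∀ v, P.guard.Sat v → ∀ r ∈ P.joint.support, ¬ P.guard.Sat (P.F v r) →
    h (Loc.inn, P.F v r) ≤ ζ

/-- `h` is a difference-bounded supermartingale map for the loop `P`. -/
def IsDiffBoundedSupermartingaleMap (P : WhileLoop n m) (h : Config n → ℝ) : Prop :=
  ∃ δ > 0, ∃ ζ > 0, P.MapConditions h δ ζ

end WhileLoop

/-- The termination time `min {k | ℓ_k = out}` of a path, where `min ∅ = ∞`. -/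
def terminationTime {n : ℕ} (ω : ℕ → Config n) : ℕ∞ :=
  ⨅ (k : ℕ) (_ : (ω k).1 = Loc.out), (k : ℕ∞)

end ProbLoop

end

namespace ProbLoop

/-! Fix a small t > 0 and put b = 1 + t²δ²/4. A bounded step that does not raise the mean of h, yet
changes h by at least δ on average, multiplies the mean of exp(-t h) by at least b, by convexity
(`exp_growth_of_supermartingale_step`). Hence b⁻ⁿ exp(-t h) is a submartingale until exit. As h ≥ 0
along the run, its value is at most b⁻ᵏ if the loop still runs after k steps, and at most 1
otherwise. With S the survival probability this gives exp(-t h(v)) ≤ 1 - S + S b⁻ᵏ, which is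
`survival_mul_le`.

For t = 1/√(k+1) the factor 1 - b⁻ᵏ stays away from 0, while 1 - exp(-t h(v)) ≤ t h(v); so S =
O(1/√k). Letting k → ∞ gives almost sure termination. -/

open Finset in
theorem one_add_add_sq_div_four_le_exp {x : ℝ} (hx : |x| ≤ 1) :
    1 + x + x ^ 2 / 4 ≤ Real.exp x := by
  have h := (abs_le.1 (Real.exp_bound hx (n := 3) (by norm_num))).1
  simp only [sum_range_succ, sum_range_zero] at h
  -- The Taylor remainder is at most (2/9)|x|³, and 1/2 - 2/9 ≥ 1/4.
  norm_num [Nat.factorial] at h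
  have h3 : |x| ^ 3 ≤ x ^ 2 := by
    rw [← sq_abs x]
    exact pow_le_pow_of_le_one (abs_nonneg x) hx (by norm_num)
  nlinarith [sq_nonneg x]

/-! ### Weighted sums and exponential growth in one step -/

section Weights

variable {ι : Type*} {w : ι → ℝ}

/-- The bound is asked only where the weight is non-zero, because the map conditions control h only
on the support of the samples. -/
theorem summable_weight_mul (hw0 : ∀ r, 0 ≤ w r) (hw : Summable w) {f : ι → ℝ} (C : ℝ)
    (hf : ∀ r, w r ≠ 0 → |f r| ≤ C) : Summable fun r => w r * f r := by
  refine Summable.of_norm_bounded (hw.mul_right C) fun r => ?_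
  rw [Real.norm_eq_abs, abs_mul, abs_of_nonneg (hw0 r)]
  by_cases h : w r = 0
  · simp [h]
  · exact mul_le_mul_of_nonneg_left (hf r h) (hw0 r)

theorem summable_weight_mul_exp (hw0 : ∀ r, 0 ≤ w r) (hw : Summable w) {H : ι → ℝ}
    {a ζ t : ℝ} (ht : 0 ≤ t) (hb : ∀ r, w r ≠ 0 → |H r - a| ≤ ζ) :
    Summable fun r => w r * Real.exp (-(t * H r)) := by
  refine summable_weight_mul hw0 hw (Real.exp (t * (ζ - a))) fun r hr => ?_
  rw [Real.abs_exp, Real.exp_le_exp]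
  have := (abs_le.1 (hb r hr)).1
  nlinarith

/-- A bounded step that does not increase the mean and has mean absolute value at least `δ`
increases the mean of an exponential by a factor quadratic in the rate. -/
theorem exp_growth_of_supermartingale_step (hw0 : ∀ r, 0 ≤ w r) (hw : HasSum w 1) {H : ι → ℝ}
    {a ζ δ t : ℝ} (hδ : 0 ≤ δ) (ht : 0 ≤ t) (htζ : t * ζ ≤ 1)
    (hb : ∀ r, w r ≠ 0 → |H r - a| ≤ ζ) (hsup : ∑' r, w r * H r ≤ a)
    (hch : δ ≤ ∑' r, w r * |H r - a|) :
    Real.exp (-(t * a)) * (1 + t ^ 2 * δ ^ 2 / 4) ≤ ∑' r, w r * Real.exp (-(t * H r)) := by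
  have hsH : Summable fun r => w r * H r := by
    refine summable_weight_mul hw0 hw.summable (ζ + |a|) fun r hr => ?_
    calc |H r| = |(H r - a) + a| := by ring_nf
      _ ≤ |H r - a| + |a| := abs_add_le _ _
      _ ≤ ζ + |a| := by linarith [hb r hr]
  have hsA : Summable fun r => w r * |H r - a| :=
    summable_weight_mul hw0 hw.summable ζ fun r hr => by rw [abs_abs]; exact hb r hr
  set E := Real.exp (-(t * a)) with hE
  have hE0 : 0 < E := Real.exp_pos _
  have hsum := ((hw.mul_left (1 + t * a - t ^ 2 * δ ^ 2 / 4)).add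
    ((hsA.hasSum.mul_left (t ^ 2 * δ / 2)).sub (hsH.hasSum.mul_left t))).mul_left E
  refine le_trans ?_ (hasSum_le (fun r => ?_) hsum
    (summable_weight_mul_exp hw0 hw.summable ht hb).hasSum)
  · refine mul_le_mul_of_nonneg_left ?_ hE0.le
    have h1 := mul_le_mul_of_nonneg_left hsup ht
    have h2 := mul_le_mul_of_nonneg_left hch (by positivity : 0 ≤ t ^ 2 * δ / 2)
    nlinarith
  · by_cases hr : w r = 0
    · simp [hr]
    have hx : |-(t * (H r - a))| ≤ 1 := by
      rw [abs_neg, abs_mul, abs_of_nonneg ht]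
      exact (mul_le_mul_of_nonneg_left (hb r hr) ht).trans htζ
    have hexp := one_add_add_sq_div_four_le_exp hx
    have hsplit : Real.exp (-(t * H r)) = E * Real.exp (-(t * (H r - a))) := by
      rw [hE, ← Real.exp_add]; ring_nf
    -- The tangent of x² at δ bounds the square below by an expression linear in |H r - a|, so the
    -- mean absolute change suffices.
    have hsq : 2 * δ * |H r - a| - δ ^ 2 ≤ (H r - a) ^ 2 := by
      rw [← sq_abs (H r - a)]; nlinarith [sq_nonneg (|H r - a| - δ)]
    have hkey : 1 + t * a - t ^ 2 * δ ^ 2 / 4 + (t ^ 2 * δ / 2 * |H r - a| - t * H r) ≤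
        Real.exp (-(t * (H r - a))) := by
      nlinarith [mul_le_mul_of_nonneg_left hsq (sq_nonneg t)]
    rw [hsplit]
    have := mul_le_mul_of_nonneg_left hkey (mul_nonneg (hw0 r) hE0.le)
    calc _ = w r * E * (1 + t * a - t ^ 2 * δ ^ 2 / 4 +
          (t ^ 2 * δ / 2 * |H r - a| - t * H r)) := by ring
      _ ≤ _ := this
      _ = _ := by ring

end Weights

/-! ### Survival probabilities and their decay -/

namespace WhileLoop

variable {n m : ℕ} (P : WhileLoop n m)

/-- The joint distribution of the samples, as real numbers. -/
noncomputable def weight (r : RVal m) : ℝ := (P.joint r).toReal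

theorem weight_nonneg (r : RVal m) : 0 ≤ P.weight r := ENNReal.toReal_nonneg

theorem hasSum_weight : HasSum P.weight 1 := by
  have h := (ENNReal.summable_toReal P.joint.tsum_coe_ne_top).hasSum
  rwa [← ENNReal.tsum_toReal_eq fun r => P.joint.apply_ne_top r, P.joint.tsum_coe,
    ENNReal.toReal_one] at h

variable {P} in
theorem mem_support_of_weight_ne_zero {r : RVal m} (h : P.weight r ≠ 0) :
    r ∈ P.joint.support := by
  rw [PMF.mem_support_iff]
  rintro h0
  simp [weight, h0] at h

open Classical in
/-- The probability that the loop, started in a valuation, is still running after `k` steps. -/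
noncomputable def survival : ℕ → PVal n → ℝ
  | 0, _ => 1
  | k + 1, v => if P.guard.Sat v then ∑' r, P.weight r * survival k (P.F v r) else 0

theorem survival_mem_Icc (k : ℕ) (v : PVal n) : P.survival k v ∈ Set.Icc (0 : ℝ) 1 := by
  induction k generalizing v with
  | zero => simp [survival]
  | succ k ih =>
    by_cases hv : P.guard.Sat v
    · simp only [survival, hv, if_true]
      refine ⟨tsum_nonneg fun r => mul_nonneg (P.weight_nonneg r) (ih _).1, ?_⟩
      refine hasSum_le (fun r => ?_) (summable_weight_mul P.weight_nonneg P.hasSum_weight.summable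
        1 fun r _ => ?_).hasSum P.hasSum_weight
      · exact mul_le_of_le_one_right (P.weight_nonneg r) (ih _).2
      · rw [abs_of_nonneg (ih _).1]; exact (ih _).2
    · simp [survival, hv]

theorem summable_weight_mul_survival (k : ℕ) (v : PVal n) :
    Summable fun r => P.weight r * P.survival k (P.F v r) :=
  summable_weight_mul P.weight_nonneg P.hasSum_weight.summable 1 fun r _ => by
    rw [abs_of_nonneg (P.survival_mem_Icc k _).1]; exact (P.survival_mem_Icc k _).2

variable {P}

/-- Optional stopping for the submartingale of exponentials, carried out as an induction on k
through the first step of the loop. -/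
theorem survival_mul_le {h : Config n → ℝ} {δ ζ : ℝ} (hδ : 0 < δ)
    (hh : P.MapConditions h δ ζ) {t : ℝ} (ht : 0 ≤ t) (htζ : t * ζ ≤ 1) (k : ℕ) (v : PVal n)
    (hv : 0 ≤ h (.inn, v)) :
    P.survival k v * (1 - (1 + t ^ 2 * δ ^ 2 / 4)⁻¹ ^ k) ≤
      1 - Real.exp (-(t * h (.inn, v))) := by
  have hnonneg : ∀ {a : ℝ}, 0 ≤ a → 0 ≤ 1 - Real.exp (-(t * a)) := fun ha => by
    rw [sub_nonneg, Real.exp_le_one_iff]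
    exact neg_nonpos.2 (mul_nonneg ht ha)
  have hc : 0 ≤ t ^ 2 * δ ^ 2 / 4 := by positivity
  set b : ℝ := 1 + t ^ 2 * δ ^ 2 / 4 with hb
  have hb0 : 0 < b := by linarith
  have hμ0 : 0 ≤ b⁻¹ := by positivity
  have hμ1 : b⁻¹ ≤ 1 := inv_le_one_of_one_le₀ (by linarith)
  induction k generalizing v with
  | zero => simpa using hnonneg hv
  | succ k ih =>
    by_cases hg : P.guard.Sat v
    · simp only [survival, hg, if_true]
      have hbd : ∀ r, P.weight r ≠ 0 → |h (.inn, P.F v r) - h (.inn, v)| ≤ ζ := fun r hr =>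
        hh.d4_change v hg r (mem_support_of_weight_ne_zero hr)
      have hgrow := exp_growth_of_supermartingale_step P.weight_nonneg P.hasSum_weight hδ.le ht htζ
        hbd (hh.d3_super v hg) (hh.d3_change v hg)
      have hle := hasSum_le (fun r => ?_)
        ((P.summable_weight_mul_survival k v).hasSum.mul_right (1 - b⁻¹ ^ (k + 1)))
        (P.hasSum_weight.sub ((summable_weight_mul_exp P.weight_nonneg P.hasSum_weight.summable
          ht hbd).hasSum.mul_left b⁻¹))
      · refine hle.trans (sub_le_sub_left ?_ 1)
        rw [le_inv_mul_iff₀ hb0, mul_comm]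
        exact hgrow
      · by_cases hr : P.weight r = 0
        · simp [hr]
        have h1 := ih (P.F v r)
          (hδ.le.trans (hh.d2_after v hg r (mem_support_of_weight_ne_zero hr)))
        have h2 := (P.survival_mem_Icc k (P.F v r)).2
        have h3 := mul_le_mul_of_nonneg_left h1 hμ0
        have h4 := mul_le_mul_of_nonneg_left h2 (sub_nonneg.2 hμ1)
        -- Uses 1 - μ^(k+1) = μ(1 - μ^k) + (1 - μ) with μ = b⁻¹: the induction hypothesis bounds the
        -- first part, survival ≤ 1 the second.
        have h5 : P.survival k (P.F v r) * (1 - b⁻¹ ^ (k + 1)) ≤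
            1 - b⁻¹ * Real.exp (-(t * h (.inn, P.F v r))) := by
          rw [pow_succ]; linarith
        calc _ = P.weight r * (P.survival k (P.F v r) * (1 - b⁻¹ ^ (k + 1))) := by ring
          _ ≤ _ := mul_le_mul_of_nonneg_left h5 (P.weight_nonneg r)
          _ = _ := by ring
    · simpa [survival, hg] using hnonneg hv

theorem survival_le_div_sqrt {h : Config n → ℝ} {δ ζ : ℝ} (hδ : 0 < δ)
    (hh : P.MapConditions h δ ζ) {v : PVal n} (hv : 0 ≤ h (.inn, v)) {k : ℕ} (hk : 1 ≤ k)
    (hkζ : ζ ^ 2 ≤ k + 1) :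
    P.survival k v ≤ h (.inn, v) * (1 + 8 / δ ^ 2) * (1 / Real.sqrt (k + 1 : ℕ)) := by
  have hk1 : (1 : ℝ) ≤ k := by exact_mod_cast hk
  push_cast
  set s := Real.sqrt ((k : ℝ) + 1) with hs
  have hs0 : 0 < s := Real.sqrt_pos.2 (by positivity)
  have hss : s ^ 2 = k + 1 := Real.sq_sqrt (by positivity)
  have htζ : 1 / s * ζ ≤ 1 := by
    rw [one_div, inv_mul_le_iff₀ hs0, mul_one]
    exact Real.le_sqrt_of_sq_le hkζ
  have hmain := survival_mul_le hδ hh (by positivity : 0 ≤ 1 / s) htζ k v hv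
  have hexp : 1 - Real.exp (-(1 / s * h (.inn, v))) ≤ 1 / s * h (.inn, v) := by
    linarith [Real.add_one_le_exp (-(1 / s * h (.inn, v)))]
  -- Bernoulli's inequality, with k/(k+1) ≥ 1/2 turning δ²/4 into δ²/8.
  have hbern : 1 + δ ^ 2 / 8 ≤ (1 + (1 / s) ^ 2 * δ ^ 2 / 4) ^ k := by
    refine le_trans ?_ (one_add_mul_le_pow ?_ k)
    · rw [one_div, inv_pow, hss, add_le_add_iff_left, ← sub_nonneg]
      have : (k : ℝ) * (((k : ℝ) + 1)⁻¹ * δ ^ 2 / 4) - δ ^ 2 / 8 =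
          (k - 1) * δ ^ 2 / (8 * (k + 1)) := by
        field_simp; ring
      rw [this]
      exact div_nonneg (mul_nonneg (by linarith) (sq_nonneg δ)) (by positivity)
    · have : 0 ≤ (1 / s) ^ 2 * δ ^ 2 / 4 := by positivity
      linarith
  have hfac : (1 + 8 / δ ^ 2)⁻¹ ≤ 1 - (1 + (1 / s) ^ 2 * δ ^ 2 / 4)⁻¹ ^ k := by
    rw [inv_pow]
    have h1 := inv_anti₀ (by positivity) hbern
    have h2 : (1 + 8 / δ ^ 2)⁻¹ = 1 - (1 + δ ^ 2 / 8)⁻¹ := by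
      field_simp; ring
    linarith
  have h3 := mul_le_mul_of_nonneg_left hfac (P.survival_mem_Icc k v).1
  rw [← div_eq_mul_inv] at h3
  have h4 : P.survival k v / (1 + 8 / δ ^ 2) ≤ 1 / s * h (.inn, v) := by linarith
  rw [div_le_iff₀ (by positivity)] at h4
  linarith

theorem exists_survival_le {h : Config n → ℝ} {δ ζ : ℝ} (hδ : 0 < δ)
    (hh : P.MapConditions h δ ζ) (v : PVal n) :
    ∃ C : ℝ, ∀ᶠ k : ℕ in atTop, P.survival k v ≤ C * (1 / Real.sqrt (k + 1 : ℕ)) := by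
  by_cases hg : P.guard.Sat v
  · refine ⟨h (.inn, v) * (1 + 8 / δ ^ 2), ?_⟩
    filter_upwards [eventually_ge_atTop 1, eventually_ge_atTop ⌈ζ ^ 2⌉₊] with k hk hkζ
    refine survival_le_div_sqrt hδ hh (hδ.le.trans (hh.d2_before v hg)) hk ?_
    have := Nat.ceil_le.1 hkζ
    linarith
  -- Here h may be negative at v, but the loop exits in its first step.
  · refine ⟨0, ?_⟩
    filter_upwards [eventually_ge_atTop 1] with k hk
    obtain ⟨j, rfl⟩ := Nat.exists_eq_add_of_le' hk
    simp [survival, hg]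

/-! ### Survival as a probability on paths -/

variable (P)

instance (v : PVal n) : IsProbabilityMeasure (P.pathMeasure v) :=
  inferInstanceAs (IsProbabilityMeasure (Kernel.trajMeasure _ _))

/-- The joint law of the history up to k and the next configuration is a composition product whose
kernel sees only coordinate k. -/
theorem lintegral_pathMeasure_succ (v : PVal n) (k : ℕ) (f : Config n → ℝ≥0∞) :
    ∫⁻ ω, f (ω (k + 1)) ∂P.pathMeasure v =
      ∫⁻ ω, ∫⁻ s, f s ∂P.stepKernel (ω k) ∂P.pathMeasure v := by
  have hf : Measurable f := Measurable.of_discrete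
  have h := Kernel.map_frestrictLe_trajMeasure_compProd_eq_map_trajMeasure
    (X := fun _ => Config n) (μ₀ := Measure.dirac ((Loc.inn, v) : Config n))
    (κ := P.historyKernel) (a := k)
  have h2 := congrArg (fun μ => ∫⁻ p, f p.2 ∂μ) h
  rw [Measure.lintegral_compProd (by fun_prop),
    lintegral_map (by fun_prop) (by fun_prop), lintegral_map (by fun_prop) (by fun_prop)] at h2
  exact h2.symm

theorem lintegral_pathMeasure_zero (v : PVal n) (f : Config n → ℝ≥0∞) :
    ∫⁻ ω, f (ω 0) ∂P.pathMeasure v = f (.inn, v) := by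
  have hf : Measurable f := Measurable.of_discrete
  have h : (P.pathMeasure v).map (Preorder.frestrictLe 0) =
      (Measure.dirac ((Loc.inn, v) : Config n)).map
        (MeasurableEquiv.piUnique (fun _ : Finset.Iic 0 => Config n)).symm := by
    rw [pathMeasure, Kernel.trajMeasure, Measure.map_comp _ _ (by fun_prop),
      Kernel.traj_map_frestrictLe, Kernel.partialTraj_self, Measure.id_comp]
  have h2 := congrArg (fun μ => ∫⁻ x, f (x ⟨0, Finset.mem_Iic.2 le_rfl⟩) ∂μ) h
  rw [lintegral_map (by fun_prop) (by fun_prop), lintegral_map (by fun_prop) (by fun_prop),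
    lintegral_dirac] at h2
  exact h2

/-- The survival probability as a function of configurations. -/
noncomputable def survivalAt (k : ℕ) : Config n → ℝ≥0∞
  | (.inn, v) => ENNReal.ofReal (P.survival k v)
  | (.out, _) => 0

theorem lintegral_stepKernel_survivalAt (k : ℕ) (s : Config n) :
    ∫⁻ s', P.survivalAt k s' ∂P.stepKernel s = P.survivalAt (k + 1) s := by
  have hf : Measurable (P.survivalAt k) := Measurable.of_discrete
  change ∫⁻ s', P.survivalAt k s' ∂(P.step s).toMeasure = _
  obtain ⟨_ | _, v⟩ := s
  · by_cases hg : P.guard.Sat v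
    · simp only [step, hg, if_true]
      rw [show P.survivalAt (k + 1) (.inn, v) =
          ENNReal.ofReal (∑' r, P.weight r * P.survival k (P.F v r)) by
            simp [survivalAt, survival, hg], ← PMF.toMeasure_map (p := P.joint) (hf := Measurable.of_discrete), lintegral_map hf Measurable.of_discrete,
        lintegral_countable', ENNReal.ofReal_tsum_of_nonneg
          (fun r => mul_nonneg (P.weight_nonneg r) (P.survival_mem_Icc k _).1)
          (P.summable_weight_mul_survival k v)]
      refine tsum_congr fun r => ?_
      rw [ENNReal.ofReal_mul (P.weight_nonneg r), weight,
        ENNReal.ofReal_toReal (P.joint.apply_ne_top r), mul_comm,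
        PMF.toMeasure_apply_singleton _ _ (measurableSet_singleton r)]
      rfl
    · simp [step, hg, survivalAt, survival, PMF.toMeasure_pure]
  · simp [step, survivalAt, PMF.toMeasure_pure]

/-- The Markov property trades one step of time for one step of the recursion, so j must vary in the
induction. For j = 0 the integrand is the indicator of `Loc.inn`. -/
theorem lintegral_survivalAt (v : PVal n) (j k : ℕ) :
    ∫⁻ ω, P.survivalAt j (ω k) ∂P.pathMeasure v = ENNReal.ofReal (P.survival (j + k) v) := by
  induction k generalizing j with
  | zero => rw [lintegral_pathMeasure_zero]; rfl
  | succ k ih =>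
    rw [lintegral_pathMeasure_succ]
    simp only [lintegral_stepKernel_survivalAt]
    rw [ih]
    congr 2
    ring

theorem pathMeasure_inn (v : PVal n) (k : ℕ) :
    P.pathMeasure v {ω | (ω k).1 = Loc.inn} = ENNReal.ofReal (P.survival k v) := by
  have hset : MeasurableSet {ω : ℕ → Config n | (ω k).1 = Loc.inn} :=
    measurableSet_eq_fun (by fun_prop) measurable_const
  rw [← lintegral_indicator_one hset, ← zero_add k, ← lintegral_survivalAt, zero_add]
  refine lintegral_congr fun ω => ?_
  rcases h : ω k with ⟨_ | _, u⟩ <;> simp [h, survivalAt, survival]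

theorem pathMeasure_succ_le_terminationTime (v : PVal n) (k : ℕ) :
    P.pathMeasure v {ω | ((k + 1 : ℕ) : ℕ∞) ≤ terminationTime ω} ≤
      ENNReal.ofReal (P.survival k v) := by
  rw [← pathMeasure_inn]
  refine measure_mono fun ω hω => ?_
  rcases h : (ω k).1 with _ | _
  · exact h
  · have h1 : terminationTime ω ≤ k := iInf₂_le k h
    have h2 : ((k + 1 : ℕ) : ℕ∞) ≤ (k : ℕ∞) := le_trans hω h1
    exact absurd (Nat.cast_le.1 h2) (by omega)

end WhileLoop

theorem terminationTime_lt_top_iff {n : ℕ} (ω : ℕ → Config n) :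
    terminationTime ω < ⊤ ↔ ∃ k, (ω k).1 = Loc.out := by
  simp [terminationTime, iInf_lt_iff]

theorem measurableSet_terminationTime_lt_top {n : ℕ} :
    MeasurableSet {ω : ℕ → Config n | terminationTime ω < ⊤} := by
  simp only [terminationTime_lt_top_iff, Set.ofPred_exists]
  exact MeasurableSet.iUnion fun k => measurableSet_eq_fun (by fun_prop) measurable_const

end ProbLoop

open ProbLoop WhileLoop in
theorem mainTheorem2 {n m : ℕ} (P : ProbLoop.WhileLoop n m)
    (hP : ∃ h : ProbLoop.Config n → ℝ, P.IsDiffBoundedSupermartingaleMap h)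
    (v₀ : ProbLoop.PVal n) :
    P.pathMeasure v₀ {ω | ProbLoop.terminationTime ω < ⊤} = 1 ∧
      (fun k : ℕ => (P.pathMeasure v₀ {ω | (k : ℕ∞) ≤ ProbLoop.terminationTime ω}).toReal)
        =O[atTop] (fun k : ℕ => 1 / Real.sqrt (k : ℝ)) := by
  obtain ⟨h, δ, hδ, ζ, -, hh⟩ := hP
  obtain ⟨C, hC⟩ := exists_survival_le hδ hh v₀
  have hbound : ∀ᶠ k : ℕ in atTop,
      (P.pathMeasure v₀ {ω | (k : ℕ∞) ≤ terminationTime ω}).toReal ≤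
        C * (1 / Real.sqrt (k : ℝ)) := by
    -- The shift by one matches T ≥ k + 1 with survival of k steps.
    rw [← map_add_atTop_eq_nat 1, eventually_map]
    filter_upwards [hC] with k hk
    exact (ENNReal.toReal_le_of_le_ofReal (P.survival_mem_Icc k v₀).1
      (P.pathMeasure_succ_le_terminationTime v₀ k)).trans hk
  refine ⟨?_, Asymptotics.IsBigO.of_bound C ?_⟩
  · rw [prob_compl_eq_zero_iff measurableSet_terminationTime_lt_top |>.symm]
    have hlim : Tendsto (fun k : ℕ => C * (1 / Real.sqrt (k : ℝ))) atTop (nhds 0) := by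
      simpa using (tendsto_inv_atTop_zero.comp
        (Real.tendsto_sqrt_atTop.comp tendsto_natCast_atTop_atTop)).const_mul C
    have hle : (P.pathMeasure v₀ {ω | terminationTime ω < ⊤}ᶜ).toReal ≤ 0 := by
      refine ge_of_tendsto hlim (hbound.mono fun k hk => le_trans ?_ hk)
      refine ENNReal.toReal_mono (measure_ne_top _ _) (measure_mono fun ω hω => ?_)
      have : terminationTime ω = ⊤ := not_lt_top_iff.1 hω
      simp [this]
    exact ((ENNReal.toReal_eq_zero_iff _).1 (le_antisymm hle ENNReal.toReal_nonneg)).resolve_right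
      (measure_ne_top _ _)
  · filter_upwards [hbound] with k hk
    rwa [Real.norm_of_nonneg ENNReal.toReal_nonneg, Real.norm_of_nonneg (by positivity)]
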